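/- **Setting.** Let $E$ be a finite set and let $f:2^{E}\to\{0,1,2,\dots\}$ be monotone and submodular (that is, $f(S\cup\{e\})-f(S)\ge f(T\cup\{e\})-f(T)$ whenever $S\subseteq T\subseteq E$, $e\in E$); put $Q:=f(E)$ and assume $Q\ge 2$. Let $X_1,\dots,X_m$ ("items") be independent random variables with values in $E$, and let item $i$ have an integer cost $c_i\in\{1,\dots,C\}$, where $mC\ge 2$. Assume that $f(\{X_1,\dots,X_m\})=Q$ almost surely. The cost of a set of items is the sum of the costs of its members, and a set of items is feasible if $f$ of the set of its realized values equals $Q$. An *adaptive algorithm* includes items one at a time, the choice of the next item (or the decision to stop) being a function of the realizations of the items included so far; it is valid if the set it ends with is almost surely feasible. An *$r$-round adaptive algorithm* (permutation framework) starts from the empty set of items; in each round $k=1,\dots,r$ it chooses, depending only on the realizations of the items included in the earlier rounds, a threshold $\tau_k\in\{0,1,2,\dots\}$ and an ordering of the remaining items, and then includes the items one by one in this order until $f$ of the set of all values realized so far is at least $\tau_k$ (or no item is left). Its result is the set of all items included in the $r$ rounds. **Theorem.** There is an absolute constant $K>0$ such that for every integer $r\ge 1$ and every instance as above there is an $r$-round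 adaptive algorithm, with thresholds $\tau_k=\lceil Q-Q^{(r-k)/r}\rceil$ for $1\le k<r$ and $\tau_r=Q$, whose result is almost surely feasible and whose expected cost is at most $$K\cdot r\cdot Q^{1/r}\cdot \log Q\cdot \log(mC)$$ times the expected cost of every valid adaptive algorithm, in particular of the optimal one. -/

import Mathlib

open MeasureTheory ProbabilityTheory

namespace StochCover

/-- Submodularity of an integer-valued set function, by decreasing marginal contributions:
`f (T ∪ {e}) - f T ≤ f (S ∪ {e}) - f S` whenever `S ⊆ T` (written without subtraction). -/
def Submodular {E : Type*} [DecidableEq E] (f : Finset E → ℕ) : Prop :=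
  ∀ S T : Finset E, S ⊆ T → ∀ e : E, f (insert e T) + f S ≤ f (insert e S) + f T

variable {E : Type*} {m : ℕ}

/-- The value of `f` on the realization of the set `S` of items, when item `i` realizes
to `x i`. -/
def coverage [DecidableEq E] (f : Finset E → ℕ) (x : Fin m → E) (S : Finset (Fin m)) : ℕ :=
  f (S.image x)

/-- The cost of a set of items; each item is paid for once. -/
def cost (c : Fin m → ℕ) (S : Finset (Fin m)) : ℕ := ∑ i ∈ S, c i

/-- What is known once exactly the items of `S` have been realized: the value `some (x i)` for
`i ∈ S`, and `none` for all other items. -/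
def observe (x : Fin m → E) (S : Finset (Fin m)) : Fin m → Option E :=
  fun i => if i ∈ S then some (x i) else none

/-- A (fully) adaptive algorithm, as a decision tree: it either ends, or includes an item and
continues depending on what this item realizes to. -/
inductive AdaptivePolicy (m : ℕ) (E : Type*) where
  | halt : AdaptivePolicy m E
  | pick (i : Fin m) (next : E → AdaptivePolicy m E) : AdaptivePolicy m E

/-- The set of items that an adaptive algorithm includes when item `i` realizes to `x i`. -/
def AdaptivePolicy.chosen (x : Fin m → E) : AdaptivePolicy m E → Finset (Fin m)
  | .halt => ∅
  | .pick i next => insert i ((next (x i)).chosen x)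

/-- An algorithm that works in rounds (permutation framework). Before round `k = 1, 2, …` it
chooses a threshold and an ordering of the items, both depending only on the realizations of the
items included in the earlier rounds. (In the ordering, the items that are already included are
simply passed over, so only the induced ordering of the remaining items matters.) -/
structure RoundAlgorithm (m : ℕ) (E : Type*) where
  /-- the threshold of round `k`, given the current observation -/
  threshold : ℕ → (Fin m → Option E) → ℕ
  /-- the ordering of round `k`, given the current observation: position ↦ item -/
  order : ℕ → (Fin m → Option E) → Equiv.Perm (Fin m)

/-- One round: insert the items of the list one by one into the current set `S`, until the
coverage is at least `τ`. -/
def runRound [DecidableEq E] (f : Finset E → ℕ) (x : Fin m → E) (τ : ℕ) :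
    List (Fin m) → Finset (Fin m) → Finset (Fin m)
  | [], S => S
  | i :: l, S => if τ ≤ coverage f x S then S else runRound f x τ l (insert i S)

/-- The set of items included in the rounds `1, …, k`, when item `i` realizes to `x i`. -/
def RoundAlgorithm.chosen [DecidableEq E] (A : RoundAlgorithm m E) (f : Finset E → ℕ)
    (x : Fin m → E) : ℕ → Finset (Fin m)
  | 0 => ∅
  | k + 1 =>
    let S := A.chosen f x k
    let σ := observe x S
    runRound f x (A.threshold (k + 1) σ) ((List.finRange m).map (A.order (k + 1) σ)) S

end StochCover

namespace StochCover

/-! ### Product weights, independent copies and scores. -/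

section

variable {E : Type*} {m : ℕ}

/-! In every round the items are ordered greedily by score per unit of cost. The score of an item
after a set `L` is its expected gain divided by the current deficit `Q - coverage`, counted only on
the live realizations, those below the threshold. All estimates are homogeneous in the weight, so
conditional weights need no normalization.

Let `u` be the live mass after `L`, and let a competing algorithm, truncated at cost `t`, still
cover on at least half of it. Suppose that every score is at most `lam` times the cost. Run the
truncated algorithm on successive independent live copies and collect the new values in a set `W`.
Whether an item is included does not depend on its own value, so swapping one coordinate of two
copies shows that each run adds at most `lam * t` on average to the score of `W`
(`sum_setScore_le`). By submodularity, a covering run raises `f W` by at least `d` times the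
fraction of the deficit that `W` leaves open, where `d` bounds live deficits from below
(`live_mul_le_increment`). Since `f` starts at least at `Q - β * d` and cannot exceed `Q`, about `4
* β` runs force `u ≤ 13 * β * lam * t` (`liveMass_le_mul`).

Applied to the greedy item `i` and the least admissible `t`, this bounds `c i * u` by a sum of
scores over the levels `n < t`, at all of which `u` is below twice the tail mass of the competitor's
cost (`cost_mul_liveMass_le`). At one level, relative gains telescope against harmonic numbers and
sum to at most twice that tail mass times `harmonic Q`. The tail masses sum to at most the
competitor's expected cost, so a round costs at most `26 * β * harmonic Q` times that.

Conditioning on earlier observations keeps the product form. The thresholds make the ratio `β` of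
the largest initial deficit to the smallest live deficit at most `Q ^ (1 / r)` in each round. This
already gives the bound without the factor `log (m * C)`, which is inserted only at the end. -/

theorem Submodular.union [DecidableEq E] {f : Finset E → ℕ} (hf : Submodular f)
    {S T : Finset E} (h : S ⊆ T) (A : Finset E) :
    f (T ∪ A) + f S ≤ f (S ∪ A) + f T := by
  induction A using Finset.induction_on with
  | empty => simp [add_comm]
  | insert a A _ ih =>
    have := hf (S ∪ A) (T ∪ A) (Finset.union_subset_union_left h) a
    rw [Finset.union_insert, Finset.union_insert]
    omega

theorem Submodular.union_image_le [DecidableEq E] {f : Finset E → ℕ} (hf : Submodular f)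
    (R : Finset E) (y : Fin m → E) (P : Finset (Fin m)) :
    (f (R ∪ P.image y) : ℝ) - f R ≤ ∑ i ∈ P, ((f (insert (y i) R) : ℝ) - f R) := by
  induction P using Finset.induction_on with
  | empty => simp
  | insert i P hi ih =>
    have h : (f (insert (y i) (R ∪ P.image y)) : ℝ) + f R
        ≤ f (insert (y i) R) + f (R ∪ P.image y) := by
      exact_mod_cast hf R (R ∪ P.image y) Finset.subset_union_left (y i)
    rw [Finset.sum_insert hi, Finset.image_insert, Finset.union_insert]
    linarith

/-- The product weight of a realization. -/
def wt (w : Fin m → E → ℝ) (x : Fin m → E) : ℝ := ∏ i, w i (x i)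

theorem wt_nonneg {w : Fin m → E → ℝ} (hw : ∀ i e, 0 ≤ w i e) (x : Fin m → E) : 0 ≤ wt w x :=
  Finset.prod_nonneg fun i _ => hw i (x i)

/-- Exchanging one coordinate of two independent copies preserves their joint law. -/
theorem sum_sum_wt_swap [Fintype E] (w : Fin m → E → ℝ) (i : Fin m)
    (F : (Fin m → E) → (Fin m → E) → ℝ) :
    ∑ y, ∑ x, wt w y * wt w x * F y x =
      ∑ y, ∑ x, wt w y * wt w x * F (Function.update y i (x i)) (Function.update x i (y i)) := by
  let ψ : (Fin m → E) × (Fin m → E) → (Fin m → E) × (Fin m → E) :=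
    fun q => (Function.update q.1 i (q.2 i), Function.update q.2 i (q.1 i))
  have hψ : Function.Involutive ψ := by
    rintro ⟨x, y⟩
    simp [ψ]
  have hwt : ∀ q, wt w (ψ q).1 * wt w (ψ q).2 = wt w q.1 * wt w q.2 := by
    rintro ⟨x, y⟩
    simp only [wt, ψ, ← Finset.prod_mul_distrib]
    refine Finset.prod_congr rfl fun j _ => ?_
    by_cases h : j = i
    · subst h
      simp [mul_comm]
    · simp [Function.update_of_ne h]
  rw [← Fintype.sum_prod_type' (f := fun y x => wt w y * wt w x * F y x),
    ← Fintype.sum_prod_type' (f := fun y x => wt w y * wt w x *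
      F (Function.update y i (x i)) (Function.update x i (y i))),
    ← Equiv.sum_comp (hψ.toPerm ψ)]
  refine Finset.sum_congr rfl fun q _ => ?_
  simp only [Function.Involutive.coe_toPerm, hwt]
  rfl

/-- Whether the threshold has not been reached yet, as a number. -/
def live [DecidableEq E] (f : Finset E → ℕ) (τ : ℕ) (L : Finset (Fin m)) (x : Fin m → E) : ℝ :=
  if coverage f x L < τ then 1 else 0

/-- The weight of the realizations for which the items of `L` do not reach the threshold. -/
def liveMass [Fintype E] [DecidableEq E] (f : Finset E → ℕ) (τ : ℕ) (p : (Fin m → E) → ℝ)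
    (L : Finset (Fin m)) : ℝ := ∑ x, p x * live f τ L x

/-- The expected relative decrease of the deficit, below the threshold, by item `i` after `L`. -/
noncomputable def score [Fintype E] [DecidableEq E] (f : Finset E → ℕ) (Q τ : ℕ)
    (p : (Fin m → E) → ℝ) (L : Finset (Fin m)) (i : Fin m) : ℝ :=
  ∑ x, p x * live f τ L x *
    (((coverage f x (insert i L) : ℝ) - coverage f x L) / ((Q : ℝ) - coverage f x L))

/-- The expected relative decrease of the deficit by a set of values `W` after `L`. -/
noncomputable def setScore [Fintype E] [DecidableEq E] (f : Finset E → ℕ) (Q τ : ℕ)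
    (p : (Fin m → E) → ℝ) (L : Finset (Fin m)) (W : Finset E) : ℝ :=
  ∑ x, p x * live f τ L x *
    (((f (L.image x ∪ W) : ℝ) - coverage f x L) / ((Q : ℝ) - coverage f x L))

section

variable [DecidableEq E] {f : Finset E → ℕ} {Q τ : ℕ}

theorem live_nonneg (L : Finset (Fin m)) (x : Fin m → E) : 0 ≤ live f τ L x := by
  unfold live; split_ifs <;> norm_num

theorem live_le_one (L : Finset (Fin m)) (x : Fin m → E) : live f τ L x ≤ 1 := by
  unfold live; split_ifs <;> norm_num

theorem image_update_of_notMem {L : Finset (Fin m)} {i : Fin m} (hi : i ∉ L) (x : Fin m → E)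
    (e : E) : L.image (Function.update x i e) = L.image x :=
  Finset.image_congr fun j hj => Function.update_of_ne (by rintro rfl; exact hi hj) _ _

theorem coverage_update_of_notMem {L : Finset (Fin m)} {i : Fin m} (hi : i ∉ L) (x : Fin m → E)
    (e : E) : coverage f (Function.update x i e) L = coverage f x L := by
  rw [coverage, image_update_of_notMem hi, coverage]

theorem live_update_of_notMem {L : Finset (Fin m)} {i : Fin m} (hi : i ∉ L) (x : Fin m → E)
    (e : E) : live f τ L (Function.update x i e) = live f τ L x := by
  rw [live, coverage_update_of_notMem hi, live]

theorem coverage_mono (hm : Monotone f) (x : Fin m → E) {S T : Finset (Fin m)} (h : S ⊆ T) :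
    coverage f x S ≤ coverage f x T := hm (Finset.image_subset_image h)

variable [Fintype E]

theorem setScore_union_le (hf : Submodular f) (hQ : ∀ W, f W ≤ Q) {p : (Fin m → E) → ℝ}
    (hp : ∀ x, 0 ≤ p x) (L : Finset (Fin m)) (W A : Finset E) :
    setScore f Q τ p L (W ∪ A) ≤ setScore f Q τ p L W + setScore f Q τ p L A := by
  unfold setScore
  rw [← Finset.sum_add_distrib]
  refine Finset.sum_le_sum fun x _ => ?_
  rw [← mul_add, ← add_div]
  refine mul_le_mul_of_nonneg_left ?_ (mul_nonneg (hp x) (live_nonneg _ _))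
  have h1 : (coverage f x L : ℝ) ≤ Q := by exact_mod_cast hQ _
  refine div_le_div_of_nonneg_right ?_ (by linarith)
  have h2 : (f (L.image x ∪ W ∪ A) : ℝ) + f (L.image x) ≤ f (L.image x ∪ A) + f (L.image x ∪ W) := by
    exact_mod_cast hf.union Finset.subset_union_left A
  rw [Finset.union_assoc] at h2
  simp only [coverage]
  linarith

/-- Running an algorithm on an independent copy gains at most the best score times the cost. -/
theorem sum_setScore_le (hf : Submodular f) (hQ : ∀ W, f W ≤ Q)
    {w : Fin m → E → ℝ} (hw : ∀ i e, 0 ≤ w i e) {c : Fin m → ℕ} (L : Finset (Fin m))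
    {T : (Fin m → E) → Finset (Fin m)}
    (hT : ∀ x i e, i ∈ T (Function.update x i e) ↔ i ∈ T x) {t : ℕ}
    (hTt : ∀ x, cost c (T x) ≤ t) {lam : ℝ} (hlam : 0 ≤ lam)
    (hsc : ∀ i, score f Q τ (wt w) L i ≤ lam * c i) :
    ∑ y, wt w y * live f τ L y * setScore f Q τ (wt w) L ((T y \ L).image y) ≤
      lam * t * liveMass f τ (wt w) L := by
  let G : Fin m → (Fin m → E) → E → ℝ := fun i x e =>
    ((f (insert e (L.image x)) : ℝ) - coverage f x L) / ((Q : ℝ) - coverage f x L)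
  let I : Fin m → (Fin m → E) → ℝ := fun i y => if i ∈ T y \ L then 1 else 0
  have hg : ∀ x, 0 ≤ (Q : ℝ) - coverage f x L := fun x => by
    have : (coverage f x L : ℝ) ≤ Q := by exact_mod_cast hQ _
    linarith
  have h1 : ∀ x y, ((f (L.image x ∪ (T y \ L).image y) : ℝ) - coverage f x L) /
      ((Q : ℝ) - coverage f x L) ≤ ∑ i, I i y * G i x (y i) := by
    intro x y
    have := div_le_div_of_nonneg_right (hf.union_image_le (L.image x) y (T y \ L)) (hg x)
    refine this.trans (le_of_eq ?_)
    rw [Finset.sum_div]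
    simp only [I, ite_mul, one_mul, zero_mul, Finset.sum_ite_mem, Finset.univ_inter]
    rfl
  -- For `i ∉ L`, swapping coordinate `i` affects neither liveness nor the decision to include `i`.
  -- It turns the gain of a foreign value into the gain of the own value of `x`, so the double sum
  -- factors.
  have hswap : ∀ i, ∑ y, ∑ x, wt w y * wt w x *
        (live f τ L y * live f τ L x * (I i y * G i x (y i))) =
      (∑ y, wt w y * live f τ L y * I i y) * score f Q τ (wt w) L i := by
    intro i
    rw [sum_sum_wt_swap w i, score, Finset.sum_mul_sum]
    refine Finset.sum_congr rfl fun y _ => Finset.sum_congr rfl fun x _ => ?_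
    by_cases hi : i ∈ L
    · simp [I, hi]
    · have hI : I i (Function.update y i (x i)) = I i y := by
        simp only [I, Finset.mem_sdiff, hT]
      have hG : G i (Function.update x i (y i)) (x i) =
          ((coverage f x (insert i L) : ℝ) - coverage f x L) / ((Q : ℝ) - coverage f x L) := by
        simp only [G, coverage_update_of_notMem hi, image_update_of_notMem hi]
        rw [coverage, coverage, Finset.image_insert]
      rw [live_update_of_notMem hi, live_update_of_notMem hi, hI, Function.update_self, hG]
      ring
  calc ∑ y, wt w y * live f τ L y * setScore f Q τ (wt w) L ((T y \ L).image y)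
      ≤ ∑ y, ∑ x, wt w y * wt w x *
        (live f τ L y * live f τ L x * ∑ i, I i y * G i x (y i)) := by
        refine Finset.sum_le_sum fun y _ => ?_
        rw [setScore, Finset.mul_sum]
        refine Finset.sum_le_sum fun x _ => ?_
        have := mul_le_mul_of_nonneg_left (h1 x y)
          (mul_nonneg (mul_nonneg (wt_nonneg hw y) (live_nonneg (f := f) (τ := τ) L y))
            (mul_nonneg (wt_nonneg hw x) (live_nonneg (f := f) (τ := τ) L x)))
        calc _ = _ := by ring
          _ ≤ _ := this
          _ = _ := by ring
    _ = ∑ i, ∑ y, ∑ x, wt w y * wt w x *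
        (live f τ L y * live f τ L x * (I i y * G i x (y i))) := by
        symm
        rw [Finset.sum_comm]
        refine Finset.sum_congr rfl fun y _ => ?_
        rw [Finset.sum_comm]
        refine Finset.sum_congr rfl fun x _ => ?_
        rw [Finset.mul_sum, Finset.mul_sum]
    _ = ∑ i, (∑ y, wt w y * live f τ L y * I i y) * score f Q τ (wt w) L i :=
        Finset.sum_congr rfl fun i _ => hswap i
    _ ≤ ∑ i, (∑ y, wt w y * live f τ L y * I i y) * (lam * c i) := by
        refine Finset.sum_le_sum fun i _ => mul_le_mul_of_nonneg_left (hsc i) ?_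
        refine Finset.sum_nonneg fun y _ => mul_nonneg (mul_nonneg (wt_nonneg hw y)
          (live_nonneg _ _)) ?_
        simp only [I]; split_ifs <;> norm_num
    _ = lam * ∑ y, wt w y * live f τ L y * ∑ i, I i y * c i := by
        simp only [Finset.sum_mul, Finset.mul_sum]
        rw [Finset.sum_comm]
        refine Finset.sum_congr rfl fun y _ => Finset.sum_congr rfl fun i _ => by ring
    _ ≤ lam * ∑ y, wt w y * live f τ L y * t := by
        refine mul_le_mul_of_nonneg_left (Finset.sum_le_sum fun y _ =>
          mul_le_mul_of_nonneg_left ?_ (mul_nonneg (wt_nonneg hw y) (live_nonneg _ _))) hlam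
        have h2 : ∑ i, I i y * (c i : ℝ) = (cost c (T y \ L) : ℝ) := by
          simp only [I, ite_mul, one_mul, zero_mul, Finset.sum_ite_mem, Finset.univ_inter, cost]
          push_cast; rfl
        have h3 : cost c (T y \ L) ≤ t :=
          (Finset.sum_le_sum_of_subset Finset.sdiff_subset).trans (hTt y)
        rw [h2]; exact_mod_cast h3
    _ = lam * t * liveMass f τ (wt w) L := by
        rw [liveMass, ← Finset.sum_mul]; ring

end

end

/-! ### Repeated runs on independent copies. -/

section

variable {E : Type*} {m : ℕ} [DecidableEq E] {f : Finset E → ℕ} {Q τ : ℕ}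

/-- If `P` covers, adding its new values to `L.image y ∪ W` reaches `Q`. By submodularity these
values gain at least as much over `W` alone, namely the deficit `g` of `L` times `1 - q`, where `q`
is the relative gain of `W`. If `P` does not cover, monotonicity suffices. -/
theorem live_mul_le_increment (hm : Monotone f) (hf : Submodular f)
    {d : ℝ} (hd0 : 0 < d) (hd : ∀ n : ℕ, n < τ → d ≤ (Q : ℝ) - n)
    (L P : Finset (Fin m)) (W : Finset E) (y : Fin m → E) :
    live f τ L y * (d * ((if coverage f y P = Q then 1 else 0) -
      ((f (L.image y ∪ W) : ℝ) - coverage f y L) / ((Q : ℝ) - coverage f y L))) ≤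
      live f τ L y * ((f (W ∪ (P \ L).image y) : ℝ) - f W) := by
  unfold live
  split_ifs with hl hdone
  · have hg : d ≤ (Q : ℝ) - coverage f y L := hd _ hl
    have h1 : f (L.image y ∪ W ∪ (P \ L).image y) + f W ≤
        f (W ∪ (P \ L).image y) + f (L.image y ∪ W) :=
      hf.union Finset.subset_union_right _
    have h2 : Q ≤ f (L.image y ∪ W ∪ (P \ L).image y) := by
      rw [← hdone]
      refine hm ?_
      intro a ha
      obtain ⟨i, hi, rfl⟩ := Finset.mem_image.1 ha
      by_cases hL : i ∈ L
      · exact Finset.mem_union_left _ (Finset.mem_union_left _ (Finset.mem_image_of_mem _ hL))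
      · exact Finset.mem_union_right _ (Finset.mem_image_of_mem _ (by simp [hi, hL]))
    have h3 : (Q : ℝ) + f W ≤ f (W ∪ (P \ L).image y) + f (L.image y ∪ W) := by
      exact_mod_cast (Nat.add_le_add_right h2 _).trans h1
    set g := (Q : ℝ) - coverage f y L with hgdef
    set q := ((f (L.image y ∪ W) : ℝ) - coverage f y L) / g with hq
    have hgq : g * q = (f (L.image y ∪ W) : ℝ) - coverage f y L := by
      rw [hq, mul_div_cancel₀ _ (by linarith)]
    -- Replacing `g` by the smaller `d` needs `1 - q ≥ 0`; otherwise the claimed lower bound is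
    -- negative.
    by_cases hq1 : q ≤ 1
    · have h4 : 0 ≤ (g - d) * (1 - q) := mul_nonneg (by linarith) (by linarith)
      nlinarith
    · have h5 : (f W : ℝ) ≤ f (W ∪ (P \ L).image y) := by
        exact_mod_cast hm Finset.subset_union_left
      have h6 : 0 ≤ d * (q - 1) := mul_nonneg hd0.le (by linarith)
      linarith
  · have hg : d ≤ (Q : ℝ) - coverage f y L := hd _ hl
    have h5 : (f W : ℝ) ≤ f (W ∪ (P \ L).image y) := by
      exact_mod_cast hm Finset.subset_union_left
    have h6 : (coverage f y L : ℝ) ≤ f (L.image y ∪ W) := by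
      exact_mod_cast hm Finset.subset_union_left
    have h7 : 0 ≤ ((f (L.image y ∪ W) : ℝ) - coverage f y L) / ((Q : ℝ) - coverage f y L) :=
      div_nonneg (by linarith) (by linarith)
    have h8 := mul_nonneg hd0.le h7
    linarith
  · simp
  · simp

variable [Fintype E]

/-- The left side bounds from below `u` times the expected value of `f` after `k` more runs started
from `W`. Before the run of index `j`, counted from zero, the score of `W` has grown by at most `j *
lam * t` on average, whence the triangular term. Quantifying over all `W` lets the induction average
over the first run. -/
theorem liveMass_mul_add_le (hm : Monotone f) (hf : Submodular f) (hQ : ∀ W, f W ≤ Q)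
    {w : Fin m → E → ℝ} (hw : ∀ i e, 0 ≤ w i e) {c : Fin m → ℕ} {L : Finset (Fin m)}
    {T : (Fin m → E) → Finset (Fin m)}
    (hT : ∀ x i e, i ∈ T (Function.update x i e) ↔ i ∈ T x) {t : ℕ}
    (hTt : ∀ x, cost c (T x) ≤ t) {lam : ℝ} (hlam : 0 ≤ lam)
    (hsc : ∀ i, score f Q τ (wt w) L i ≤ lam * c i)
    {d : ℝ} (hd0 : 0 < d) (hd : ∀ n : ℕ, n < τ → d ≤ (Q : ℝ) - n)
    (hu : 0 < liveMass f τ (wt w) L) {a : ℝ}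
    (ha : a = ∑ y, wt w y * live f τ L y * (if coverage f y (T y) = Q then 1 else 0))
    (k : ℕ) : ∀ W : Finset E,
    liveMass f τ (wt w) L * f W + k * d * a - k * d * setScore f Q τ (wt w) L W
      - k * (k - 1) / 2 * d * (lam * t) ≤ liveMass f τ (wt w) L * Q := by
  set u := liveMass f τ (wt w) L with hudef
  have hpl : ∀ y, 0 ≤ wt w y * live f τ L y := fun y =>
    mul_nonneg (wt_nonneg hw y) (live_nonneg _ _)
  have husum : ∑ y, wt w y * live f τ L y = u := rfl
  induction k with
  | zero =>
    intro W
    have : (f W : ℝ) ≤ Q := by exact_mod_cast hQ W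
    have := mul_le_mul_of_nonneg_left this hu.le
    simp only [CharP.cast_eq_zero]
    linarith
  | succ k ih =>
    intro W
    have hS := sum_setScore_le hf hQ hw L hT hTt hlam hsc
    have hinc : u * f W + d * a - d * setScore f Q τ (wt w) L W ≤
        ∑ y, wt w y * live f τ L y * f (W ∪ (T y \ L).image y) := by
      have h1 : ∑ y, wt w y * live f τ L y * (d * ((if coverage f y (T y) = Q then 1 else 0) -
          ((f (L.image y ∪ W) : ℝ) - coverage f y L) / ((Q : ℝ) - coverage f y L))) ≤
          ∑ y, wt w y * live f τ L y * ((f (W ∪ (T y \ L).image y) : ℝ) - f W) := by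
        refine Finset.sum_le_sum fun y _ => ?_
        have := mul_le_mul_of_nonneg_left
          (live_mul_le_increment hm hf hd0 hd L (T y) W y) (wt_nonneg hw y)
        rw [mul_assoc, mul_assoc]
        exact this
      have h2 : ∑ y, wt w y * live f τ L y * ((f (W ∪ (T y \ L).image y) : ℝ) - f W) =
          ∑ y, wt w y * live f τ L y * f (W ∪ (T y \ L).image y) - u * f W := by
        rw [← husum, Finset.sum_mul, ← Finset.sum_sub_distrib]
        exact Finset.sum_congr rfl fun y _ => by ring
      have h3 : ∑ y, wt w y * live f τ L y * (d * ((if coverage f y (T y) = Q then 1 else 0) -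
          ((f (L.image y ∪ W) : ℝ) - coverage f y L) / ((Q : ℝ) - coverage f y L))) =
          d * a - d * setScore f Q τ (wt w) L W := by
        rw [ha, setScore, Finset.mul_sum, Finset.mul_sum, ← Finset.sum_sub_distrib]
        exact Finset.sum_congr rfl fun y _ => by ring
      linarith
    have hsub : ∑ y, wt w y * live f τ L y * setScore f Q τ (wt w) L (W ∪ (T y \ L).image y) ≤
        u * setScore f Q τ (wt w) L W + lam * t * u := by
      calc _ ≤ ∑ y, wt w y * live f τ L y * (setScore f Q τ (wt w) L W +
            setScore f Q τ (wt w) L ((T y \ L).image y)) :=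
            Finset.sum_le_sum fun y _ => mul_le_mul_of_nonneg_left
              (setScore_union_le hf hQ (wt_nonneg hw) _ _ _) (hpl y)
        _ = u * setScore f Q τ (wt w) L W +
            ∑ y, wt w y * live f τ L y * setScore f Q τ (wt w) L ((T y \ L).image y) := by
            rw [← husum, Finset.sum_mul, ← Finset.sum_add_distrib]
            exact Finset.sum_congr rfl fun y _ => by ring
        _ ≤ _ := by linarith
    have havg : ∑ y, wt w y * live f τ L y * (u * f (W ∪ (T y \ L).image y) + k * d * a
        - k * d * setScore f Q τ (wt w) L (W ∪ (T y \ L).image y)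
        - k * (k - 1) / 2 * d * (lam * t)) ≤ ∑ y, wt w y * live f τ L y * (u * Q) :=
      Finset.sum_le_sum fun y _ => mul_le_mul_of_nonneg_left (ih _) (hpl y)
    have hl : ∑ y, wt w y * live f τ L y * (u * f (W ∪ (T y \ L).image y) + k * d * a
        - k * d * setScore f Q τ (wt w) L (W ∪ (T y \ L).image y)
        - k * (k - 1) / 2 * d * (lam * t)) =
        u * ∑ y, wt w y * live f τ L y * f (W ∪ (T y \ L).image y) + u * (k * d * a)
        - k * d * ∑ y, wt w y * live f τ L y * setScore f Q τ (wt w) L (W ∪ (T y \ L).image y)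
        - u * (k * (k - 1) / 2 * d * (lam * t)) := by
      -- Only the factors `u` of the two constant terms are expanded into sums over `y`.
      nth_rewrite 3 4 [← husum]
      simp only [Finset.sum_mul, Finset.mul_sum, ← Finset.sum_add_distrib,
        ← Finset.sum_sub_distrib]
      exact Finset.sum_congr rfl fun y _ => by ring
    rw [hl, ← Finset.sum_mul, husum] at havg
    have h4 := mul_le_mul_of_nonneg_left hinc hu.le
    have h5 := mul_le_mul_of_nonneg_left hsub (mul_nonneg k.cast_nonneg hd0.le : 0 ≤ (k : ℝ) * d)
    refine le_of_mul_le_mul_left ?_ hu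
    push_cast
    linarith

/-- While the threshold is missed with weight `u`, and an algorithm of cost at most `t` covers on
half of this, some item has score at least of order `u / (β t)` per unit of cost. -/
theorem liveMass_le_mul (hm : Monotone f) (hf : Submodular f) (hQ : ∀ W, f W ≤ Q)
    {w : Fin m → E → ℝ} (hw : ∀ i e, 0 ≤ w i e) {c : Fin m → ℕ} {L : Finset (Fin m)}
    {T : (Fin m → E) → Finset (Fin m)}
    (hT : ∀ x i e, i ∈ T (Function.update x i e) ↔ i ∈ T x) {t : ℕ}
    (hTt : ∀ x, cost c (T x) ≤ t) {lam : ℝ} (hlam : 0 ≤ lam)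
    (hsc : ∀ i, score f Q τ (wt w) L i ≤ lam * c i)
    {d : ℝ} (hd0 : 0 < d) (hd : ∀ n : ℕ, n < τ → d ≤ (Q : ℝ) - n)
    {β : ℝ} (hβ : 1 ≤ β) {B : Finset E} (hB : ∀ x, wt w x ≠ 0 → B ⊆ L.image x)
    (hD : (Q : ℝ) - f B ≤ β * d)
    (hhalf : liveMass f τ (wt w) L ≤
      2 * ∑ y, wt w y * live f τ L y * (if coverage f y (T y) = Q then 1 else 0)) :
    liveMass f τ (wt w) L ≤ 13 * β * (lam * t) := by
  have hlt : 0 ≤ lam * t := mul_nonneg hlam t.cast_nonneg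
  rcases le_or_gt (liveMass f τ (wt w) L) 0 with hu | hu
  · exact hu.trans (by positivity)
  -- With `k ≥ 4 * β` and `a ≥ u / 2`, the gain `k * a` is at least `2 * β * u`, twice the available
  -- room `β * u`. With `k ≤ 5 * β`, the loss is at most `25 / 2 * β ^ 2 * (lam * t)`, whence the
  -- constant 13.
  have key := liveMass_mul_add_le hm hf hQ hw hT hTt hlam hsc hd0 hd hu rfl ⌈4 * β⌉₊ B
  have he : setScore f Q τ (wt w) L B = 0 := by
    refine Finset.sum_eq_zero fun x _ => ?_
    by_cases hx : wt w x = 0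
    · simp [hx]
    · rw [Finset.union_eq_left.2 (hB x hx)]
      simp [coverage]
  have hk1 : 4 * β ≤ (⌈4 * β⌉₊ : ℝ) := Nat.le_ceil _
  have hk2 : (⌈4 * β⌉₊ : ℝ) ≤ 5 * β := by
    have := (Nat.ceil_lt_add_one (by linarith : 0 ≤ 4 * β)).le
    linarith
  rw [he] at key
  set k : ℝ := (⌈4 * β⌉₊ : ℝ)
  set u := liveMass f τ (wt w) L
  set a := ∑ y, wt w y * live f τ L y * (if coverage f y (T y) = Q then (1 : ℝ) else 0)
  have h1 : d * (k * a - k * (k - 1) / 2 * (lam * t)) ≤ d * (u * β) := by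
    have := mul_le_mul_of_nonneg_left hD hu.le
    linarith
  have h2 := le_of_mul_le_mul_left h1 hd0
  have hk0 : 0 ≤ k := by linarith
  have h3 : k * u ≤ k * (2 * a) := mul_le_mul_of_nonneg_left hhalf hk0
  have h4 : 4 * β * u ≤ k * u := mul_le_mul_of_nonneg_right hk1 hu.le
  have h5 : k * (k - 1) ≤ 25 * β * β := by nlinarith
  have h6 := mul_le_mul_of_nonneg_right h5 hlt
  have h7 : β * u ≤ β * (13 * β * (lam * t)) := by
    have : 0 ≤ β * β * (lam * t) := by positivity
    linarith
  exact le_of_mul_le_mul_left h7 (by linarith)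

end

section

/-! ### Adaptive algorithms and their truncation by cost. -/

section Policy

variable {E : Type*} {m : ℕ}

/-- Whether an item is included does not depend on its own realization. -/
theorem AdaptivePolicy.mem_chosen_update (π : AdaptivePolicy m E) (x : Fin m → E) (i : Fin m)
    (e : E) : i ∈ π.chosen (Function.update x i e) ↔ i ∈ π.chosen x := by
  induction π with
  | halt => rfl
  | pick j next ih =>
    by_cases h : i = j
    · simp [AdaptivePolicy.chosen, h]
    · simp only [AdaptivePolicy.chosen, Finset.mem_insert, h, false_or,
        Function.update_of_ne (Ne.symm h), ih]

/-- The algorithm that ends before the total cost exceeds `t`, where the items of `P` are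
already paid for. -/
def AdaptivePolicy.trunc (c : Fin m → ℕ) (t : ℕ) :
    AdaptivePolicy m E → Finset (Fin m) → AdaptivePolicy m E
  | .halt, _ => .halt
  | .pick i next, P =>
    if cost c (insert i P) ≤ t then .pick i fun e => (next e).trunc c t (insert i P) else .halt

theorem cost_mono (c : Fin m → ℕ) {S T : Finset (Fin m)} (h : S ⊆ T) : cost c S ≤ cost c T :=
  Finset.sum_le_sum_of_subset h

theorem cost_insert_le (c : Fin m → ℕ) (i : Fin m) (S : Finset (Fin m)) :
    cost c (insert i S) ≤ cost c S + c i := by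
  by_cases h : i ∈ S
  · simp [h]
  · rw [cost, Finset.sum_insert h, cost, add_comm]

theorem AdaptivePolicy.cost_trunc_le (π : AdaptivePolicy m E) (c : Fin m → ℕ) (t : ℕ)
    (x : Fin m → E) : ∀ P : Finset (Fin m), cost c P ≤ t →
      cost c (P ∪ (π.trunc c t P).chosen x) ≤ t := by
  induction π with
  | halt => intro P hP; simpa [trunc, chosen] using hP
  | pick j next ih =>
    intro P hP
    rw [trunc]
    split_ifs with h
    · rw [chosen, Finset.union_insert, ← Finset.insert_union]
      exact ih _ _ h
    · simpa [chosen] using hP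

theorem AdaptivePolicy.chosen_trunc (π : AdaptivePolicy m E) (c : Fin m → ℕ) (t : ℕ)
    (x : Fin m → E) : ∀ P : Finset (Fin m), cost c (P ∪ π.chosen x) ≤ t →
      (π.trunc c t P).chosen x = π.chosen x := by
  induction π with
  | halt => intro P _; rfl
  | pick j next ih =>
    intro P hP
    rw [chosen, Finset.union_insert, ← Finset.insert_union] at hP
    rw [trunc, if_pos ((cost_mono c Finset.subset_union_left).trans hP), chosen, chosen,
      ih _ _ hP]

end Policy

/-! ### Greedy orderings and sums along them. -/

section Path

variable {m : ℕ}

/-- The sum of `F L i` over the items `i` of a list, where `L` consists of the initial set and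
the preceding items. -/
def pathSum (F : Finset (Fin m) → Fin m → ℝ) : List (Fin m) → Finset (Fin m) → ℝ
  | [], _ => 0
  | i :: l, L => F L i + pathSum F l (insert i L)

/-- A list ordered greedily by score per cost. -/
def Greedy (c : Fin m → ℕ) (sc : Finset (Fin m) → Fin m → ℝ) :
    List (Fin m) → Finset (Fin m) → Prop
  | [], _ => True
  | i :: l, L => (∀ j, sc L j * c i ≤ sc L i * c j) ∧ Greedy c sc l (insert i L)

/-- Maximizing over the remaining items `R` is enough: an item outside `R` lies in `L` and has score
zero. -/
theorem exists_greedy {c : Fin m → ℕ} (hc : ∀ i, 1 ≤ c i)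
    {sc : Finset (Fin m) → Fin m → ℝ} (h0 : ∀ L i, 0 ≤ sc L i) (hmem : ∀ L, ∀ i ∈ L, sc L i = 0)
    (n : ℕ) : ∀ R L : Finset (Fin m), R.card = n → (∀ j, j ∉ R → j ∈ L) →
      ∃ l : List (Fin m), l.Nodup ∧ l.toFinset = R ∧ Greedy c sc l L := by
  induction n with
  | zero =>
    intro R L hR _
    rw [Finset.card_eq_zero] at hR
    exact ⟨[], by simp [hR, Greedy]⟩
  | succ n ih =>
    intro R L hR hRL
    have hne : R.Nonempty := Finset.card_pos.1 (by omega)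
    obtain ⟨i, hi, hmax⟩ := Finset.exists_max_image R (fun j => sc L j / c j) hne
    obtain ⟨l, hl, hlR, hg⟩ := ih (R.erase i) (insert i L)
      (by rw [Finset.card_erase_of_mem hi]; omega) (by
        intro j hj
        by_cases h : j = i
        · simp [h]
        · exact Finset.mem_insert_of_mem (hRL j fun hjR => hj (Finset.mem_erase.2 ⟨h, hjR⟩)))
    refine ⟨i :: l, ?_, ?_, ?_, hg⟩
    · refine List.nodup_cons.2 ⟨fun hil => ?_, hl⟩
      rw [← List.mem_toFinset, hlR] at hil
      simp at hil
    · rw [List.toFinset_cons, hlR, Finset.insert_erase hi]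
    · intro j
      have hcpos : ∀ k, (0 : ℝ) < c k := fun k => by exact_mod_cast hc k
      by_cases hj : j ∈ R
      · have := hmax j hj
        rwa [div_le_div_iff₀ (hcpos j) (hcpos i)] at this
      · rw [hmem L j (hRL j hj), zero_mul]
        exact mul_nonneg (h0 L i) (hcpos j).le

theorem exists_perm_greedy {c : Fin m → ℕ} (hc : ∀ i, 1 ≤ c i)
    {sc : Finset (Fin m) → Fin m → ℝ} (h0 : ∀ L i, 0 ≤ sc L i) (hmem : ∀ L, ∀ i ∈ L, sc L i = 0)
    (S : Finset (Fin m)) :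
    ∃ e : Equiv.Perm (Fin m), Greedy c sc ((List.finRange m).map e) S := by
  obtain ⟨l, hl, hlu, hg⟩ := exists_greedy hc h0 hmem _ Finset.univ S rfl (by simp)
  have hmeml : ∀ i, i ∈ l := fun i => by rw [← List.mem_toFinset, hlu]; simp
  have hlen : l.length = m := by
    rw [← List.toFinset_card_of_nodup hl, hlu, Finset.card_univ, Fintype.card_fin]
  refine ⟨(finCongr hlen.symm).trans (hl.getEquivOfForallMemList l hmeml), ?_⟩
  convert hg
  refine List.ext_getElem (by simp [hlen]) fun n h1 h2 => ?_
  simp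

theorem pathSum_le_of_greedy {c : Fin m → ℕ} {sc : Finset (Fin m) → Fin m → ℝ}
    {F G : Finset (Fin m) → Fin m → ℝ} {S : Finset (Fin m)}
    (h : ∀ L i, S ⊆ L → (∀ j, sc L j * c i ≤ sc L i * c j) → F L i ≤ G L i)
    (l : List (Fin m)) : ∀ L, S ⊆ L → Greedy c sc l L → pathSum F l L ≤ pathSum G l L := by
  induction l with
  | nil => intro L _ _; exact le_rfl
  | cons i l ih =>
    intro L hL hg
    exact add_le_add (h L i hL hg.1) (ih _ (hL.trans (Finset.subset_insert _ _)) hg.2)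

theorem pathSum_mono {F G : Finset (Fin m) → Fin m → ℝ} (h : ∀ L i, F L i ≤ G L i)
    (l : List (Fin m)) : ∀ L, pathSum F l L ≤ pathSum G l L := by
  induction l with
  | nil => intro L; exact le_rfl
  | cons i l ih => intro L; exact add_le_add (h L i) (ih _)

theorem pathSum_sum {ι : Type*} (s : Finset ι) (a : ι → ℝ)
    (F : ι → Finset (Fin m) → Fin m → ℝ) (l : List (Fin m)) : ∀ L,
    pathSum (fun L i => ∑ n ∈ s, a n * F n L i) l L = ∑ n ∈ s, a n * pathSum (F n) l L := by
  induction l with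
  | nil => intro L; simp [pathSum]
  | cons i l ih => intro L; simp [pathSum, ih, mul_add, Finset.sum_add_distrib]

end Path

/-! ### Cost of a round and the harmonic potential. -/

variable {E : Type*} {m : ℕ} [DecidableEq E] {f : Finset E → ℕ} {Q τ : ℕ}

theorem cost_runRound_le (x : Fin m → E) (c : Fin m → ℕ) (l : List (Fin m)) :
    ∀ S, (cost c (runRound f x τ l S) : ℝ) ≤
      cost c S + pathSum (fun L i => c i * live f τ L x) l S := by
  have h0 : ∀ l L, 0 ≤ pathSum (fun L i => (c i : ℝ) * live f τ L x) l L := by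
    intro l
    induction l with
    | nil => intro L; exact le_rfl
    | cons i l ih =>
      intro L
      exact add_nonneg (mul_nonneg (Nat.cast_nonneg _) (live_nonneg _ _)) (ih _)
  induction l with
  | nil => intro S; simp [runRound, pathSum]
  | cons i l ih =>
    intro S
    rw [runRound]
    split_ifs with h
    · have := h0 (i :: l) S
      linarith
    · have h1 := ih (insert i S)
      have h2 : (cost c (insert i S) : ℝ) ≤ cost c S + c i := by exact_mod_cast cost_insert_le c i S
      have h3 : live f τ S x = 1 := by rw [live, if_pos (by omega)]
      rw [pathSum, h3]
      linarith

theorem subset_runRound (x : Fin m → E) (l : List (Fin m)) :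
    ∀ S, S ⊆ runRound f x τ l S := by
  induction l with
  | nil => intro S; exact subset_rfl
  | cons i l ih =>
    intro S
    rw [runRound]
    split_ifs
    · exact subset_rfl
    · exact (Finset.subset_insert _ _).trans (ih _)

theorem le_coverage_runRound (x : Fin m → E) (l : List (Fin m)) :
    ∀ S, τ ≤ coverage f x (S ∪ l.toFinset) → τ ≤ coverage f x (runRound f x τ l S) := by
  induction l with
  | nil => intro S h; simpa [runRound] using h
  | cons i l ih =>
    intro S h
    rw [runRound]
    split_ifs with h1
    · exact h1
    · refine ih _ ?_
      rwa [List.toFinset_cons, Finset.union_insert, ← Finset.insert_union] at h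

theorem coverage_congr {x x' : Fin m → E} {S : Finset (Fin m)} (h : ∀ i ∈ S, x i = x' i) :
    coverage f x S = coverage f x' S := by
  rw [coverage, coverage, Finset.image_congr h]

theorem runRound_congr {x x' : Fin m → E} (l : List (Fin m)) :
    ∀ S, (∀ i ∈ runRound f x τ l S, x i = x' i) → runRound f x' τ l S = runRound f x τ l S := by
  induction l with
  | nil => intro S _; rfl
  | cons i l ih =>
    intro S h
    have hc : coverage f x S = coverage f x' S :=
      coverage_congr fun j hj => h j (subset_runRound x (i :: l) S hj)
    rw [runRound] at h
    rw [runRound, runRound, ← hc]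
    split_ifs with h1
    · rfl
    · rw [if_neg h1] at h
      exact ih _ h

theorem sub_div_le_harmonic_sub {a b N : ℕ} (hab : b ≤ a) (haN : a ≤ N) :
    ((a : ℝ) - b) / N ≤ (harmonic a : ℝ) - harmonic b := by
  induction a, hab using Nat.le_induction with
  | base => simp
  | succ a _ ih =>
    have h1 := ih (by omega)
    have h2 : (1 : ℝ) / N ≤ ((a + 1 : ℕ) : ℝ)⁻¹ := by
      rw [one_div]
      exact inv_anti₀ (by positivity) (by exact_mod_cast haN)
    rw [harmonic_succ]
    push_cast at h2 ⊢
    have h3 : ((a : ℝ) + 1 - b) / N = ((a : ℝ) - b) / N + 1 / N := by ring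
    linarith

variable [Fintype E]

theorem score_nonneg (hm : Monotone f) (hQ : ∀ W, f W ≤ Q) {p : (Fin m → E) → ℝ}
    (hp : ∀ x, 0 ≤ p x) (L : Finset (Fin m)) (i : Fin m) : 0 ≤ score f Q τ p L i := by
  refine Finset.sum_nonneg fun x _ => mul_nonneg (mul_nonneg (hp x) (live_nonneg _ _)) ?_
  have h1 : (coverage f x L : ℝ) ≤ Q := by exact_mod_cast hQ _
  have h2 : (coverage f x L : ℝ) ≤ coverage f x (insert i L) := by
    exact_mod_cast coverage_mono hm x (Finset.subset_insert _ _)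
  exact div_nonneg (by linarith) (by linarith)

theorem score_of_mem {p : (Fin m → E) → ℝ} {L : Finset (Fin m)} {i : Fin m} (hi : i ∈ L) :
    score f Q τ p L i = 0 := by
  simp [score, Finset.insert_eq_of_mem hi]

/-- For each realization, the harmonic number of the deficit is a potential: it drops by at least
the relative gain of the inserted item. -/
theorem pathSum_score_le (hm : Monotone f) (hQ : ∀ W, f W ≤ Q) {p : (Fin m → E) → ℝ}
    (hp : ∀ x, 0 ≤ p x) (hτ : τ ≤ Q) (l : List (Fin m)) : ∀ L,
    pathSum (score f Q τ p) l L ≤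
      ∑ x, p x * live f τ L x * (harmonic (Q - coverage f x L) : ℝ) := by
  have hh : ∀ n, (0 : ℝ) ≤ harmonic n := fun n => by
    have := sub_div_le_harmonic_sub (Nat.zero_le n) le_rfl
    simp only [CharP.cast_eq_zero, sub_zero, harmonic_zero, Rat.cast_zero] at this
    exact (by positivity : (0 : ℝ) ≤ (n : ℝ) / n).trans this
  induction l with
  | nil =>
    intro L
    exact Finset.sum_nonneg fun x _ => mul_nonneg (mul_nonneg (hp x) (live_nonneg _ _)) (hh _)
  | cons i l ih =>
    intro L
    rw [pathSum]
    refine (add_le_add_right (ih _) _).trans ?_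
    rw [score, ← Finset.sum_add_distrib]
    refine Finset.sum_le_sum fun x _ => ?_
    rw [mul_assoc, mul_assoc, mul_assoc, ← mul_add]
    refine mul_le_mul_of_nonneg_left ?_ (hp x)
    have hmono := coverage_mono hm x (Finset.subset_insert i L)
    have h1 := hQ ((insert i L).image x)
    change coverage f x (insert i L) ≤ Q at h1
    by_cases h : coverage f x L < τ
    · have h2 := sub_div_le_harmonic_sub (a := Q - coverage f x L)
        (b := Q - coverage f x (insert i L)) (by omega) le_rfl
      rw [Nat.cast_sub (hmono.trans h1), Nat.cast_sub h1] at h2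
      have h3 : live f τ (insert i L) x * (harmonic (Q - coverage f x (insert i L)) : ℝ) ≤
          harmonic (Q - coverage f x (insert i L)) :=
        mul_le_of_le_one_left (hh _) (live_le_one _ _)
      have h4 : live f τ L x = 1 := by rw [live, if_pos h]
      rw [h4, one_mul, one_mul]
      have h5 : ((Q : ℝ) - coverage f x L - (Q - coverage f x (insert i L))) =
        coverage f x (insert i L) - coverage f x L := by ring
      rw [h5] at h2
      linarith
    · have h4 : live f τ L x = 0 := by rw [live, if_neg h]
      have h5 : live f τ (insert i L) x = 0 := by rw [live, if_neg (by omega)]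
      simp [h4, h5]

theorem harmonic_mono' {a b : ℕ} (h : b ≤ a) : (harmonic b : ℝ) ≤ harmonic a := by
  have h1 := sub_div_le_harmonic_sub h le_rfl
  have h2 : (b : ℝ) ≤ a := by exact_mod_cast h
  have h3 : 0 ≤ ((a : ℝ) - b) / a := div_nonneg (by linarith) (Nat.cast_nonneg _)
  linarith

/-- Nothing is counted before the first prefix with live mass below `θ`; from there on, the
potential is at most `θ * harmonic Q`. -/
theorem pathSum_ite_score_le (hm : Monotone f) (hQ : ∀ W, f W ≤ Q) {p : (Fin m → E) → ℝ}
    (hp : ∀ x, 0 ≤ p x) (hτ : τ ≤ Q) {θ : ℝ} (hθ : 0 ≤ θ) (l : List (Fin m)) : ∀ L,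
    pathSum (fun L i => if liveMass f τ p L < θ then score f Q τ p L i else 0) l L ≤
      θ * harmonic Q := by
  have hH : (0 : ℝ) ≤ harmonic Q := by simpa using harmonic_mono' (Nat.zero_le Q)
  induction l with
  | nil => intro L; exact mul_nonneg hθ hH
  | cons i l ih =>
    intro L
    by_cases h : liveMass f τ p L < θ
    · refine (pathSum_mono (G := score f Q τ p) (fun L i => ?_) _ _).trans
        ((pathSum_score_le hm hQ hp hτ _ _).trans ?_)
      · split_ifs
        · exact le_rfl
        · exact score_nonneg hm hQ hp _ _
      · refine le_trans ?_ (mul_le_mul_of_nonneg_right h.le hH)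
        rw [liveMass, Finset.sum_mul]
        exact Finset.sum_le_sum fun x _ => mul_le_mul_of_nonneg_left
          (harmonic_mono' (Nat.sub_le _ _)) (mul_nonneg (hp x) (live_nonneg _ _))
    · rw [pathSum, if_neg h, zero_add]
      exact ih _

end

/-! ### Charging a round to the cost tail of a competitor. -/

section

variable {E : Type*} {m : ℕ} {f : Finset E → ℕ} {Q τ : ℕ}

/-- The weight of the realizations for which an algorithm costs more than `t`. -/
def tailMass [Fintype E] (p : (Fin m → E) → ℝ) (c : Fin m → ℕ) (π : AdaptivePolicy m E) (t : ℕ) : ℝ :=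
  ∑ x, p x * if t < cost c (π.chosen x) then 1 else 0

theorem tailMass_nonneg [Fintype E] {p : (Fin m → E) → ℝ} (hp : ∀ x, 0 ≤ p x) (c : Fin m → ℕ)
    (π : AdaptivePolicy m E) (t : ℕ) : 0 ≤ tailMass p c π t :=
  Finset.sum_nonneg fun x _ => mul_nonneg (hp x) (by split_ifs <;> norm_num)

theorem sum_tailMass_le [Fintype E] {p : (Fin m → E) → ℝ} (hp : ∀ x, 0 ≤ p x) (c : Fin m → ℕ)
    (π : AdaptivePolicy m E) (N : ℕ) :
    ∑ n ∈ Finset.range N, tailMass p c π n ≤ ∑ x, p x * (cost c (π.chosen x) : ℝ) := by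
  unfold tailMass
  rw [Finset.sum_comm]
  refine Finset.sum_le_sum fun x _ => ?_
  rw [← Finset.mul_sum]
  refine mul_le_mul_of_nonneg_left ?_ (hp x)
  rw [Finset.sum_boole]
  refine Nat.cast_le.2 ((Finset.card_le_card (t := Finset.range (cost c (π.chosen x))) ?_).trans
    (Finset.card_range _).le)
  intro n hn
  simpa using (Finset.mem_filter.1 hn).2

/-- The cost of a greedy item, weighted by the probability that it is needed, is bounded by its
score. -/
theorem cost_mul_liveMass_le [DecidableEq E] [Fintype E] (hm : Monotone f) (hf : Submodular f) (hQ : ∀ W, f W ≤ Q)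
    {w : Fin m → E → ℝ} (hw : ∀ i e, 0 ≤ w i e) {c : Fin m → ℕ} (hc : ∀ i, 1 ≤ c i)
    {L : Finset (Fin m)} {π : AdaptivePolicy m E}
    (hπ : ∀ x, wt w x ≠ 0 → coverage f x (π.chosen x) = Q)
    {d : ℝ} (hd0 : 0 < d) (hd : ∀ n : ℕ, n < τ → d ≤ (Q : ℝ) - n)
    {β : ℝ} (hβ : 1 ≤ β) {B : Finset E} (hB : ∀ x, wt w x ≠ 0 → B ⊆ L.image x)
    (hD : (Q : ℝ) - f B ≤ β * d) {i : Fin m}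
    (hi : ∀ j, score f Q τ (wt w) L j * c i ≤ score f Q τ (wt w) L i * c j) :
    c i * liveMass f τ (wt w) L ≤ ∑ n ∈ Finset.range (cost c Finset.univ), 13 * β *
      if liveMass f τ (wt w) L < 2 * tailMass (wt w) c π n
        then score f Q τ (wt w) L i else 0 := by
  set N := cost c (Finset.univ : Finset (Fin m)) with hN
  set u := liveMass f τ (wt w) L with hu
  have hp := wt_nonneg hw
  have hu0 : 0 ≤ u := Finset.sum_nonneg fun x _ => mul_nonneg (hp x) (live_nonneg _ _)
  have hs0 : 0 ≤ score f Q τ (wt w) L i := score_nonneg hm hQ hp L i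
  have hci : (0 : ℝ) < c i := by exact_mod_cast hc i
  have hex : ∃ t, 2 * tailMass (wt w) c π t ≤ u := by
    refine ⟨N, le_trans (le_of_eq ?_) hu0⟩
    rw [tailMass, Finset.sum_eq_zero, mul_zero]
    intro x _
    rw [if_neg (not_lt.2 (cost_mono c (Finset.subset_univ _))), mul_zero]
  classical
  -- Minimality of `t` serves twice: truncation at `t` loses at most half of the live mass, and
  -- every `n < t` satisfies the condition in the sum.
  set t := Nat.find hex with ht
  have htspec : 2 * tailMass (wt w) c π t ≤ u := Nat.find_spec hex
  have htN : t ≤ N := by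
    refine Nat.find_min' hex (le_trans (le_of_eq ?_) hu0)
    rw [tailMass, Finset.sum_eq_zero, mul_zero]
    intro x _
    rw [if_neg (not_lt.2 (cost_mono c (Finset.subset_univ _))), mul_zero]
  have hhalf : u ≤ 2 * ∑ y, wt w y * live f τ L y *
      (if coverage f y ((π.trunc c t ∅).chosen y) = Q then 1 else 0) := by
    have h1 : u ≤ ∑ y, wt w y * live f τ L y *
        (if coverage f y ((π.trunc c t ∅).chosen y) = Q then 1 else 0) +
        tailMass (wt w) c π t := by
      rw [hu, liveMass, tailMass, ← Finset.sum_add_distrib]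
      refine Finset.sum_le_sum fun y _ => ?_
      by_cases hy : wt w y = 0
      · simp [hy]
      rw [mul_assoc, ← mul_add]
      refine mul_le_mul_of_nonneg_left ?_ (hp y)
      by_cases hty : t < cost c (π.chosen y)
      · rw [if_pos hty]
        have h2 : 0 ≤ live f τ L y * (if coverage f y ((π.trunc c t ∅).chosen y) = Q
            then (1 : ℝ) else 0) :=
          mul_nonneg (live_nonneg _ _) (by split_ifs <;> norm_num)
        have h3 := live_le_one (f := f) (τ := τ) L y
        linarith
      · rw [π.chosen_trunc c t y ∅ (by simpa using hty), if_pos (hπ y hy), if_neg hty]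
        linarith
    linarith
  have hmain := liveMass_le_mul hm hf hQ hw (L := L) (τ := τ)
    (T := fun x => (π.trunc c t ∅).chosen x)
    (fun x i e => (π.trunc c t ∅).mem_chosen_update x i e)
    (fun x => by simpa using π.cost_trunc_le c t x ∅ (by simp [cost]))
    (lam := score f Q τ (wt w) L i / c i) (div_nonneg hs0 hci.le)
    (fun j => by
      rw [div_mul_eq_mul_div, le_div_iff₀ hci]
      exact hi j) hd0 hd hβ hB hD hhalf
  rw [← Finset.mul_sum, ← Finset.sum_filter, Finset.sum_const, nsmul_eq_mul]
  have hcard : (t : ℝ) ≤ ((Finset.range N).filter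
      fun n => u < 2 * tailMass (wt w) c π n).card := by
    refine Nat.cast_le.2 ((Finset.card_range t).ge.trans (Finset.card_le_card ?_))
    intro n hn
    have hnt := Finset.mem_range.1 hn
    exact Finset.mem_filter.2 ⟨Finset.mem_range.2 (hnt.trans_le htN),
      not_le.1 (Nat.find_min hex hnt)⟩
  calc (c i : ℝ) * u ≤ c i * (13 * β * (score f Q τ (wt w) L i / c i * t)) :=
        mul_le_mul_of_nonneg_left hmain hci.le
    _ = 13 * β * (t * score f Q τ (wt w) L i) := by field_simp
    _ ≤ _ := by
      refine mul_le_mul_of_nonneg_left ?_ (by linarith)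
      exact mul_le_mul_of_nonneg_right hcard hs0

theorem pathSum_mul_liveMass [DecidableEq E] [Fintype E] (p : (Fin m → E) → ℝ) (c : Fin m → ℕ)
    (l : List (Fin m)) (S : Finset (Fin m)) :
    pathSum (fun L i => c i * liveMass f τ p L) l S =
      ∑ x, p x * pathSum (fun L i => c i * live f τ L x) l S := by
  have h : (fun (L : Finset (Fin m)) (i : Fin m) => (c i : ℝ) * liveMass f τ p L) =
      fun L i => ∑ x, p x * (c i * live f τ L x) := by
    funext L i
    rw [liveMass, Finset.mul_sum]
    exact Finset.sum_congr rfl fun x _ => mul_left_comm _ _ _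
  rw [h]
  exact pathSum_sum Finset.univ p (fun x L i => (c i : ℝ) * live f τ L x) l S

/-- The expected cost of a single greedy round. -/
theorem sum_cost_runRound_le [DecidableEq E] [Fintype E] (hm : Monotone f) (hf : Submodular f) (hQ : ∀ W, f W ≤ Q)
    (hτ : τ ≤ Q) {w : Fin m → E → ℝ} (hw : ∀ i e, 0 ≤ w i e) {c : Fin m → ℕ} (hc : ∀ i, 1 ≤ c i)
    {S : Finset (Fin m)} {π : AdaptivePolicy m E}
    (hπ : ∀ x, wt w x ≠ 0 → coverage f x (π.chosen x) = Q)
    {d : ℝ} (hd0 : 0 < d) (hd : ∀ n : ℕ, n < τ → d ≤ (Q : ℝ) - n)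
    {β : ℝ} (hβ : 1 ≤ β) {B : Finset E} (hB : ∀ x, wt w x ≠ 0 → B ⊆ S.image x)
    (hD : (Q : ℝ) - f B ≤ β * d) {l : List (Fin m)}
    (hl : Greedy c (score f Q τ (wt w)) l S) :
    ∑ x, wt w x * ((cost c (runRound f x τ l S) : ℝ) - cost c S) ≤
      26 * β * harmonic Q * ∑ x, wt w x * (cost c (π.chosen x) : ℝ) := by
  have hp := wt_nonneg hw
  set N := cost c (Finset.univ : Finset (Fin m))
  have h1 : ∑ x, wt w x * ((cost c (runRound f x τ l S) : ℝ) - cost c S) ≤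
      ∑ x, wt w x * pathSum (fun L i => c i * live f τ L x) l S :=
    Finset.sum_le_sum fun x _ => mul_le_mul_of_nonneg_left
      (by have := cost_runRound_le (f := f) (τ := τ) x c l S; linarith) (hp x)
  have h2 : pathSum (fun L i => c i * liveMass f τ (wt w) L) l S =
      ∑ x, wt w x * pathSum (fun L i => c i * live f τ L x) l S := by
    exact pathSum_mul_liveMass _ _ _ _
  have hstep : ∀ (L : Finset (Fin m)) (i : Fin m), S ⊆ L →
      (∀ j, score f Q τ (wt w) L j * c i ≤ score f Q τ (wt w) L i * c j) →
      c i * liveMass f τ (wt w) L ≤ ∑ n ∈ Finset.range N, 13 * β *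
        if liveMass f τ (wt w) L < 2 * tailMass (wt w) c π n
          then score f Q τ (wt w) L i else 0 := fun L i hL hi => by
    have hBL : ∀ x, wt w x ≠ 0 → B ⊆ L.image x := fun x hx =>
      (hB x hx).trans (Finset.image_subset_image hL)
    exact cost_mul_liveMass_le hm hf hQ hw hc hπ hd0 hd hβ hBL hD hi
  have h3 : pathSum (fun L i => c i * liveMass f τ (wt w) L) l S ≤
      pathSum (fun L i => ∑ n ∈ Finset.range N, 13 * β *
          if liveMass f τ (wt w) L < 2 * tailMass (wt w) c π n
            then score f Q τ (wt w) L i else 0) l S :=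
    pathSum_le_of_greedy hstep l S subset_rfl hl
  have h4 := pathSum_sum (Finset.range N) (fun _ => 13 * β)
    (fun n L i => if liveMass f τ (wt w) L < 2 * tailMass (wt w) c π n
      then score f Q τ (wt w) L i else 0) l S
  have h5 : ∀ n, pathSum (fun L i => if liveMass f τ (wt w) L < 2 * tailMass (wt w) c π n
      then score f Q τ (wt w) L i else 0) l S ≤ 2 * tailMass (wt w) c π n * harmonic Q := fun n =>
    pathSum_ite_score_le hm hQ hp hτ (mul_nonneg zero_le_two (tailMass_nonneg hp c π n)) l S
  have h6 : ∑ n ∈ Finset.range N, 13 * β * pathSum (fun L i =>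
      if liveMass f τ (wt w) L < 2 * tailMass (wt w) c π n
        then score f Q τ (wt w) L i else 0) l S ≤
      26 * β * harmonic Q * ∑ n ∈ Finset.range N, tailMass (wt w) c π n := by
    rw [Finset.mul_sum]
    refine Finset.sum_le_sum fun n _ => ?_
    have := mul_le_mul_of_nonneg_left (h5 n) (by linarith : 0 ≤ 13 * β)
    linarith
  have hH : (0 : ℝ) ≤ harmonic Q := by simpa using harmonic_mono' (Nat.zero_le Q)
  have h7 := mul_le_mul_of_nonneg_left (sum_tailMass_le hp c π N)
    (mul_nonneg (by linarith : 0 ≤ 26 * β) hH)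
  linarith

/-! ### Conditioning on an observation -/

theorem observe_eq_iff {x x' : Fin m → E} {S : Finset (Fin m)} :
    observe x' S = observe x S ↔ ∀ i ∈ S, x i = x' i := by
  constructor
  · intro h i hi
    have := congrFun h i
    simpa [observe, hi, eq_comm] using this
  · intro h
    ext1 i
    by_cases hi : i ∈ S
    · simp [observe, hi, h i hi]
    · simp [observe, hi]

/-- The weights conditioned, without normalization, on an observation. -/
def condWeight [DecidableEq E] (w : Fin m → E → ℝ) (σ : Fin m → Option E) (i : Fin m) (e : E) : ℝ :=
  if σ i = none ∨ σ i = some e then w i e else 0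

/-- The set of observed items. -/
def observed (σ : Fin m → Option E) : Finset (Fin m) :=
  Finset.univ.filter fun i => σ i ≠ none

theorem observed_observe (x : Fin m → E) (S : Finset (Fin m)) : observed (observe x S) = S := by
  ext i
  simp [observed, observe]

theorem condWeight_nonneg [DecidableEq E] {w : Fin m → E → ℝ} (hw : ∀ i e, 0 ≤ w i e) (σ : Fin m → Option E)
    (i : Fin m) (e : E) : 0 ≤ condWeight w σ i e := by
  unfold condWeight
  split_ifs
  · exact hw i e
  · exact le_rfl

/-- Restricting to an observation keeps a product weight, so the one-round bound applies to it. -/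
theorem wt_condWeight [DecidableEq E] (w : Fin m → E → ℝ) (S : Finset (Fin m)) (x x' : Fin m → E) :
    wt (condWeight w (observe x S)) x' = if observe x' S = observe x S then wt w x' else 0 := by
  split_ifs with h
  · refine Finset.prod_congr rfl fun i _ => if_pos ?_
    rw [← h]
    by_cases hi : i ∈ S <;> simp [observe, hi]
  · rw [observe_eq_iff] at h
    push Not at h
    obtain ⟨i, hi, hne⟩ := h
    exact Finset.prod_eq_zero (Finset.mem_univ i) (if_neg (by simp [observe, hi, hne]))

theorem RoundAlgorithm.chosen_congr [DecidableEq E] (A : RoundAlgorithm m E) {x x' : Fin m → E} (k : ℕ)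
    (h : ∀ i ∈ A.chosen f x k, x i = x' i) : A.chosen f x' k = A.chosen f x k := by
  induction k with
  | zero => rfl
  | succ k ih =>
    rw [chosen] at h
    have h1 : ∀ i ∈ A.chosen f x k, x i = x' i := fun i hi => h i (subset_runRound _ _ _ hi)
    have h2 := ih h1
    rw [chosen, chosen, h2, observe_eq_iff.2 h1]
    exact runRound_congr _ _ h

theorem sum_cost_chosen_succ_le [DecidableEq E] [Fintype E] (hm : Monotone f) (hf : Submodular f) (hQ : ∀ W, f W ≤ Q)
    {w : Fin m → E → ℝ} (hw : ∀ i e, 0 ≤ w i e) {c : Fin m → ℕ} (hc : ∀ i, 1 ≤ c i)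
    {A : RoundAlgorithm m E} {k : ℕ} (hA : ∀ σ, A.threshold (k + 1) σ = τ) (hτ : τ ≤ Q)
    (hgreedy : ∀ σ, Greedy c (score f Q τ (wt (condWeight w σ)))
      ((List.finRange m).map (A.order (k + 1) σ)) (observed σ))
    {π : AdaptivePolicy m E}
    (hπ : ∀ x, wt w x ≠ 0 → coverage f x (π.chosen x) = Q)
    {d : ℝ} (hd0 : 0 < d) (hd : ∀ n : ℕ, n < τ → d ≤ (Q : ℝ) - n)
    {β : ℝ} (hβ : 1 ≤ β)
    (hD : ∀ x, wt w x ≠ 0 → (Q : ℝ) - coverage f x (A.chosen f x k) ≤ β * d) :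
    ∑ x, wt w x * (cost c (A.chosen f x (k + 1)) : ℝ) ≤
      ∑ x, wt w x * (cost c (A.chosen f x k) : ℝ) +
      26 * β * harmonic Q * ∑ x, wt w x * (cost c (π.chosen x) : ℝ) := by
  classical
  have hp := wt_nonneg hw
  suffices h : ∑ x, wt w x * ((cost c (A.chosen f x (k + 1)) : ℝ) - cost c (A.chosen f x k)) ≤
      26 * β * harmonic Q * ∑ x, wt w x * (cost c (π.chosen x) : ℝ) by
    simp only [mul_sub, Finset.sum_sub_distrib] at h
    linarith
  have hK : 0 ≤ 26 * β * (harmonic Q : ℝ) := mul_nonneg (by linarith)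
    (by simpa using harmonic_mono' (Nat.zero_le Q))
  let s : (Fin m → E) → Fin m → Option E := fun x => observe x (A.chosen f x k)
  -- The realizations are split by what is known before the round. Since the chosen set is
  -- determined by the values of its own items, a nonempty fibre is a cylinder over these
  -- coordinates.
  rw [← Finset.sum_fiberwise Finset.univ s, ← Finset.sum_fiberwise Finset.univ s
    (fun x => wt w x * (cost c (π.chosen x) : ℝ)), Finset.mul_sum]
  refine Finset.sum_le_sum fun σ _ => ?_
  by_cases hσ : ∃ x₀, s x₀ = σ ∧ wt w x₀ ≠ 0
  · obtain ⟨x₀, rfl, hx₀⟩ := hσ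
    set S := A.chosen f x₀ k with hS
    have hfib : ∀ x, s x = s x₀ ↔ observe x S = observe x₀ S := by
      intro x
      constructor
      · intro h
        have h1 := congrArg observed h
        simp only [s, observed_observe] at h1
        simpa only [s, h1] using h
      · intro h
        have h1 := A.chosen_congr (f := f) k (observe_eq_iff.1 h)
        simpa only [s, h1] using h
    have hch : ∀ x, observe x S = observe x₀ S → A.chosen f x k = S := fun x h =>
      A.chosen_congr k (observe_eq_iff.1 h)
    have hsum : ∀ g : (Fin m → E) → ℝ, ∑ x with s x = s x₀, wt w x * g x =
        ∑ x, wt (condWeight w (observe x₀ S)) x * g x := by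
      intro g
      rw [Finset.sum_filter]
      refine Finset.sum_congr rfl fun x _ => ?_
      rw [wt_condWeight, ite_mul, zero_mul]
      simp only [hfib]
    have hsupp : ∀ x, wt (condWeight w (observe x₀ S)) x ≠ 0 →
        observe x S = observe x₀ S ∧ wt w x ≠ 0 := by
      intro x hx
      rw [wt_condWeight] at hx
      by_cases h : observe x S = observe x₀ S
      · exact ⟨h, by simpa [h] using hx⟩
      · simp [h] at hx
    have hg := hgreedy (observe x₀ S)
    rw [observed_observe] at hg
    have hone := sum_cost_runRound_le hm hf hQ hτ (condWeight_nonneg hw (observe x₀ S)) hc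
      (fun x hx => hπ x (hsupp x hx).2) hd0 hd hβ (B := S.image x₀) (S := S)
      (fun x hx => (Finset.image_congr (observe_eq_iff.1 (hsupp x hx).1)).subset)
      (hD x₀ hx₀) hg
    rw [hsum, hsum]
    refine le_trans (le_of_eq ?_) hone
    refine Finset.sum_congr rfl fun x _ => ?_
    by_cases hx : wt (condWeight w (observe x₀ S)) x = 0
    · rw [hx, zero_mul, zero_mul]
    · have h1 := (hsupp x hx).1
      rw [RoundAlgorithm.chosen]
      simp only [hch x h1, h1, hA]
  · push Not at hσ
    have h0 : ∀ g : (Fin m → E) → ℝ, ∑ x with s x = σ, wt w x * g x = 0 := fun g =>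
      Finset.sum_eq_zero fun x hx => by rw [hσ x (Finset.mem_filter.1 hx).2, zero_mul]
    rw [h0, h0, mul_zero]

end

/-! ### Thresholds, all rounds together, and the passage to random variables. -/

section

variable {E : Type*} {m : ℕ}

/-- The thresholds `⌈Q - Q ^ ((r - k) / r)⌉` for `k < r`, and `Q` for `k = r`. -/
noncomputable def roundThreshold (Q r k : ℕ) : ℕ :=
  if k < r then ⌈(Q : ℝ) - (Q : ℝ) ^ (((r : ℝ) - (k : ℝ)) / (r : ℝ))⌉₊ else Q

theorem roundThreshold_le (Q r k : ℕ) : roundThreshold Q r k ≤ Q := by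
  unfold roundThreshold
  split_ifs
  · rw [Nat.ceil_le]
    have : (0 : ℝ) ≤ (Q : ℝ) ^ (((r : ℝ) - (k : ℝ)) / (r : ℝ)) := by positivity
    linarith
  · exact le_rfl

/-- This supplies `d` for round `k`. In the last round the power is 1, and integrality of `f`
provides a deficit of at least 1. -/
theorem rpow_le_sub_of_lt_roundThreshold {Q r k n : ℕ} (hk : k ≤ r) (h : n < roundThreshold Q r k) :
    (Q : ℝ) ^ (((r : ℝ) - (k : ℝ)) / (r : ℝ)) ≤ (Q : ℝ) - n := by
  unfold roundThreshold at h
  split_ifs at h with hkr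
  · rw [Nat.lt_ceil] at h
    linarith
  · have hk' : k = r := by omega
    have h1 : (n : ℝ) + 1 ≤ Q := by exact_mod_cast h
    rw [hk', sub_self, zero_div, Real.rpow_zero]
    linarith

theorem exists_roundAlgorithm [DecidableEq E] [Fintype E] {f : Finset E → ℕ} (hm : Monotone f)
    (hf : Submodular f) {Q : ℕ} (hQ : ∀ W, f W ≤ Q) (hQ1 : 1 ≤ Q)
    {w : Fin m → E → ℝ} (hw : ∀ i e, 0 ≤ w i e) {c : Fin m → ℕ} (hc : ∀ i, 1 ≤ c i)
    (hcov : ∀ x, wt w x ≠ 0 → coverage f x Finset.univ = Q) {r : ℕ} (hr : 1 ≤ r) :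
    ∃ A : RoundAlgorithm m E, (∀ k σ, A.threshold k σ = roundThreshold Q r k) ∧
      (∀ x, wt w x ≠ 0 → coverage f x (A.chosen f x r) = Q) ∧
      ∀ π : AdaptivePolicy m E, (∀ x, wt w x ≠ 0 → coverage f x (π.chosen x) = Q) →
        ∑ x, wt w x * (cost c (A.chosen f x r) : ℝ) ≤
          r * (26 * (Q : ℝ) ^ (1 / (r : ℝ)) * harmonic Q *
            ∑ x, wt w x * (cost c (π.chosen x) : ℝ)) := by
  have hex : ∀ (k : ℕ) (σ : Fin m → Option E), ∃ e : Equiv.Perm (Fin m),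
      Greedy c (score f Q (roundThreshold Q r k) (wt (condWeight w σ)))
        ((List.finRange m).map e) (observed σ) := fun k σ =>
    exists_perm_greedy hc
      (fun L i => score_nonneg hm hQ (wt_nonneg (condWeight_nonneg hw σ)) L i)
      (fun L i hi => score_of_mem hi) _
  choose ord hord using hex
  let A : RoundAlgorithm m E := ⟨fun k _ => roundThreshold Q r k, ord⟩
  have hreach : ∀ x, wt w x ≠ 0 → ∀ k,
      roundThreshold Q r (k + 1) ≤ coverage f x (A.chosen f x (k + 1)) := by
    intro x hx k
    rw [RoundAlgorithm.chosen]
    refine le_coverage_runRound x _ _ ?_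
    have hall : ((List.finRange m).map
        (A.order (k + 1) (observe x (A.chosen f x k)))).toFinset = Finset.univ := by
      ext i
      simpa using (A.order (k + 1) (observe x (A.chosen f x k))).surjective i
    rw [hall, Finset.union_eq_right.2 (Finset.subset_univ _), hcov x hx]
    exact roundThreshold_le _ _ _
  have hr0 : (r : ℝ) ≠ 0 := by exact_mod_cast (by omega : r ≠ 0)
  have hQ0 : (0 : ℝ) < Q := by exact_mod_cast hQ1
  refine ⟨A, fun _ _ => rfl, fun x hx => ?_, fun π hπ => ?_⟩
  · obtain ⟨k, rfl⟩ : ∃ k, r = k + 1 := ⟨r - 1, by omega⟩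
    have h := hreach x hx k
    rw [roundThreshold, if_neg (lt_irrefl _)] at h
    exact le_antisymm (hQ _) h
  · suffices h : ∀ k, k ≤ r → ∑ x, wt w x * (cost c (A.chosen f x k) : ℝ) ≤
        k * (26 * (Q : ℝ) ^ (1 / (r : ℝ)) * harmonic Q *
          ∑ x, wt w x * (cost c (π.chosen x) : ℝ)) from h r le_rfl
    intro k
    induction k with
    | zero => intro _; simp [RoundAlgorithm.chosen, cost]
    | succ k ih =>
      intro hk
      -- The deficit left by the previous threshold is at most `Q ^ (1 / r)` times the smallest live
      -- deficit of this round.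
      have hβd : (Q : ℝ) ^ (1 / (r : ℝ)) * (Q : ℝ) ^ (((r : ℝ) - ((k + 1 : ℕ) : ℝ)) / (r : ℝ)) =
          (Q : ℝ) ^ (((r : ℝ) - (k : ℝ)) / (r : ℝ)) := by
        rw [← Real.rpow_add hQ0]
        congr 1
        push_cast
        field_simp
        ring
      have hD : ∀ x, wt w x ≠ 0 → (Q : ℝ) - coverage f x (A.chosen f x k) ≤
          (Q : ℝ) ^ (1 / (r : ℝ)) * (Q : ℝ) ^ (((r : ℝ) - ((k + 1 : ℕ) : ℝ)) / (r : ℝ)) := by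
        intro x hx
        rw [hβd]
        rcases k with _ | k
        · rw [Nat.cast_zero, sub_zero, div_self hr0, Real.rpow_one]
          exact sub_le_self _ (Nat.cast_nonneg _)
        · have h := hreach x hx k
          rw [roundThreshold, if_pos (by omega), Nat.ceil_le] at h
          linarith
      have hβ : 1 ≤ (Q : ℝ) ^ (1 / (r : ℝ)) :=
        Real.one_le_rpow (by exact_mod_cast hQ1) (by positivity)
      have hstep := sum_cost_chosen_succ_le hm hf hQ hw hc (A := A) (k := k) (fun _ => rfl)
        (roundThreshold_le Q r (k + 1)) (hord (k + 1)) hπ (Real.rpow_pos_of_pos hQ0 _)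
        (fun n hn => rpow_le_sub_of_lt_roundThreshold hk hn) hβ hD
      have h1 := ih (by omega)
      push_cast
      linarith

section Law

variable [MeasurableSpace E] {Ω : Type*}
  [MeasurableSpace Ω] {μ : Measure Ω} [IsProbabilityMeasure μ] {X : Fin m → Ω → E}

theorem map_real_singleton (hX : ∀ i, Measurable (X i)) (hind : iIndepFun X μ) (x : Fin m → E) :
    (μ.map fun ω i => X i ω).real {x} = wt (fun i e => (μ.map (X i)).real {e}) x := by
  have : ∀ i, IsProbabilityMeasure (μ.map (X i)) := fun i =>
    Measure.isProbabilityMeasure_map (hX i).aemeasurable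
  rw [(iIndepFun_iff_map_fun_eq_pi_map fun i => (hX i).aemeasurable).1 hind, Measure.real,
    Measure.pi_singleton, ENNReal.toReal_prod]
  rfl

variable [Fintype E] [MeasurableSingletonClass E]

theorem integral_comp_eq_sum (hX : ∀ i, Measurable (X i)) (hind : iIndepFun X μ)
    (g : (Fin m → E) → ℝ) :
    ∫ ω, g (fun i => X i ω) ∂μ = ∑ x, wt (fun i e => (μ.map (X i)).real {e}) x * g x := by
  have hmeas : Measurable fun ω i => X i ω := measurable_pi_lambda _ hX
  have : IsProbabilityMeasure (μ.map fun ω i => X i ω) :=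
    Measure.isProbabilityMeasure_map hmeas.aemeasurable
  rw [← integral_map hmeas.aemeasurable (measurable_of_countable g).aestronglyMeasurable,
    integral_fintype .of_finite]
  exact Finset.sum_congr rfl fun x _ => by rw [map_real_singleton hX hind, smul_eq_mul]

theorem ae_comp_iff (hX : ∀ i, Measurable (X i)) (hind : iIndepFun X μ)
    (P : (Fin m → E) → Prop) :
    (∀ᵐ ω ∂μ, P fun i => X i ω) ↔
      ∀ x, wt (fun i e => (μ.map (X i)).real {e}) x ≠ 0 → P x := by
  have hmeas : Measurable fun ω i => X i ω := measurable_pi_lambda _ hX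
  have : IsProbabilityMeasure (μ.map fun ω i => X i ω) :=
    Measure.isProbabilityMeasure_map hmeas.aemeasurable
  rw [← ae_map_iff hmeas.aemeasurable (Set.toFinite {x | P x}).measurableSet,
    ae_iff_of_countable]
  refine forall_congr' fun x => ?_
  rw [← map_real_singleton hX hind, Measure.real, ne_eq, ne_eq,
    ENNReal.toReal_eq_zero_iff, or_iff_left (measure_ne_top _ _)]

end Law

end

end StochCover

theorem mainTheorem1 :
    ∃ K : ℝ, 0 < K ∧
      ∀ (E : Type*) [Fintype E] [DecidableEq E] [MeasurableSpace E] [MeasurableSingletonClass E]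
        (Ω : Type*) [MeasurableSpace Ω] (μ : Measure Ω) [IsProbabilityMeasure μ]
        (r m C Q : ℕ) (f : Finset E → ℕ) (c : Fin m → ℕ) (X : Fin m → Ω → E),
        1 ≤ r →
        Monotone f → StochCover.Submodular f →
        Q = f Finset.univ → 2 ≤ Q → 2 ≤ m * C →
        (∀ i, 1 ≤ c i ∧ c i ≤ C) →
        (∀ i, Measurable (X i)) → iIndepFun X μ →
        (∀ᵐ ω ∂μ, StochCover.coverage f (fun i => X i ω) Finset.univ = Q) →
        ∃ A : StochCover.RoundAlgorithm m E,
          (∀ k, 1 ≤ k → k < r → ∀ σ,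
            A.threshold k σ = ⌈(Q : ℝ) - (Q : ℝ) ^ (((r : ℝ) - (k : ℝ)) / (r : ℝ))⌉₊) ∧
          (∀ σ, A.threshold r σ = Q) ∧
          (∀ᵐ ω ∂μ, StochCover.coverage f (fun i => X i ω)
            (A.chosen f (fun i => X i ω) r) = Q) ∧
          ∀ π : StochCover.AdaptivePolicy m E,
            (∀ᵐ ω ∂μ, StochCover.coverage f (fun i => X i ω)
              (π.chosen (fun i => X i ω)) = Q) →
            ∫ ω, (StochCover.cost c (A.chosen f (fun i => X i ω) r) : ℝ) ∂μ ≤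
              K * ((r : ℝ) * (Q : ℝ) ^ (1 / (r : ℝ)) * Real.log Q * Real.log ((m : ℝ) * (C : ℝ))) *
                ∫ ω, (StochCover.cost c (π.chosen (fun i => X i ω)) : ℝ) ∂μ := by
  -- The constant is `26 * 6`: `harmonic Q ≤ 1 + log Q ≤ 3 * log Q`, and `1 ≤ 2 * log (m * C)`.
  refine ⟨156, by norm_num, ?_⟩
  intro E _ _ _ _ Ω _ μ _ r m C Q f c X hr hm hf hQ hQ2 hmC hc hX hind hcov
  have hfQ : ∀ W, f W ≤ Q := fun W => hQ ▸ hm (Finset.subset_univ W)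
  have hw : ∀ i e, 0 ≤ (μ.map (X i)).real {e} := fun _ _ => measureReal_nonneg
  obtain ⟨A, hthr, hA, hcost⟩ := StochCover.exists_roundAlgorithm hm hf hfQ (by omega) hw
    (fun i => (hc i).1) ((StochCover.ae_comp_iff hX hind _).1 hcov) hr
  refine ⟨A, fun k _ hk σ => by rw [hthr, StochCover.roundThreshold, if_pos hk],
    fun σ => by rw [hthr, StochCover.roundThreshold, if_neg (lt_irrefl _)],
    (StochCover.ae_comp_iff hX hind _).2 hA, fun π hπ => ?_⟩
  rw [StochCover.integral_comp_eq_sum hX hind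
      (fun x => (StochCover.cost c (A.chosen f x r) : ℝ)),
    StochCover.integral_comp_eq_sum hX hind (fun x => (StochCover.cost c (π.chosen x) : ℝ))]
  refine (hcost π ((StochCover.ae_comp_iff hX hind
    (fun x => StochCover.coverage f x (π.chosen x) = Q)).1 hπ)).trans ?_
  set O := ∑ x, StochCover.wt (fun i e => (μ.map (X i)).real {e}) x *
    (StochCover.cost c (π.chosen x) : ℝ)
  have hO : 0 ≤ O := Finset.sum_nonneg fun x _ =>
    mul_nonneg (StochCover.wt_nonneg hw x) (Nat.cast_nonneg _)
  have hlog : ∀ a : ℝ, 2 ≤ a → 1 ≤ 2 * Real.log a := fun a ha => by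
    have h1 := Real.log_le_log (by norm_num) ha
    have h2 := Real.log_two_gt_d9
    linarith
  have hlQ := hlog Q (by exact_mod_cast hQ2)
  have hlmC := hlog (m * C) (by exact_mod_cast hmC)
  have hH : (harmonic Q : ℝ) ≤ 3 * Real.log Q := by
    have := harmonic_le_one_add_log Q
    linarith
  have hH' : (harmonic Q : ℝ) ≤ 6 * (Real.log Q * Real.log (m * C)) := by
    have h3 : Real.log Q * 1 ≤ Real.log Q * (2 * Real.log (m * C)) :=
      mul_le_mul_of_nonneg_left hlmC (by linarith)
    linarith
  calc (r : ℝ) * (26 * (Q : ℝ) ^ (1 / (r : ℝ)) * harmonic Q * O)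
      = 26 * r * (Q : ℝ) ^ (1 / (r : ℝ)) * O * harmonic Q := by ring
    _ ≤ 26 * r * (Q : ℝ) ^ (1 / (r : ℝ)) * O * (6 * (Real.log Q * Real.log (m * C))) :=
      mul_le_mul_of_nonneg_left hH' (by positivity)
    _ = _ := by ring
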